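/- Corollary 3.1. For $x,y>0$ let $L(x,y)=\frac{x-y}{\ln x-\ln y}$ and $I(x,y)=\exp\left(\frac{x\ln x-y\ln y}{x-y}-1\right)$ if $x\neq y$, $L(x,x)=I(x,x)=x$, $G(x,y)=\sqrt{xy}$, and $Y(x,y)=I(x,y)\,e^{1-G(x,y)^2/L(x,y)^2}$. Let $a,b>0$ with $a\neq b$. For $(p,q)\in\mathbb{R}^2$ define the Stolarsky means $$S_{p,q}(a,b)=\begin{cases}\left(\frac{q(a^p-b^p)}{p(a^q-b^q)}\right)^{1/(p-q)}& p\neq q,\ pq\neq0,\\ \left(\frac{a^p-b^p}{p(\ln a-\ln b)}\right)^{1/p}& p\neq0,\ q=0,\\ \left(\frac{a^q-b^q}{q(\ln a-\ln b)}\right)^{1/q}& p=0,\ q\neq0,\\ \exp\left(\frac{a^p\ln a-b^p\ln b}{a^p-b^p}-\frac1p\right)& p=q\neq0,\\ \sqrt{ab}& p=q=0,\end{cases}$$ the Gini means $$G_{p,q}(a,b)=\begin{cases}\left(\frac{a^p+b^p}{a^q+b^q}\right)^{1/(p-q)}& p\neq q,\\ \exp\left(\frac{a^p\ln a+b^p\ln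 b}{a^p+b^p}\right)& p=q,\end{cases}$$ the two-parameter identric means $$I_{p,q}(a,b)=\begin{cases}\left(\frac{I(a^p,b^p)}{I(a^q,b^q)}\right)^{1/(p-q)}& p\neq q,\\ Y(a^p,b^p)^{1/p}& p=q\neq0,\\ \sqrt{ab}& p=q=0,\end{cases}$$ and the two-parameter Heronian means $$He_{p,q}(a,b)=\begin{cases}\left(\frac{a^p+(\sqrt{ab})^p+b^p}{a^q+(\sqrt{ab})^q+b^q}\right)^{1/(p-q)}& p\neq q,\\ a^{\frac{a^p+\frac12(\sqrt{ab})^{p}}{a^p+(\sqrt{ab})^p+b^p}}\; b^{\frac{\frac12(\sqrt{ab})^{p}+b^p}{a^p+(\sqrt{ab})^p+b^p}}& p=q.\end{cases}$$ Let $M$ be any one of these four families. Then $M_{p,q}(a,b)>0$ for all $(p,q)\in[0,\infty)^2\cup(-\infty,0]^2$, the function $(p,q)\mapsto\ln M_{p,q}(a,b)$ is strictly concave (jointly in $(p,q)$) on $[0,\infty)\times[0,\infty)$, and it is strictly convex (jointly in $(p,q)$) on $(-\infty,0]\times(-\infty,0]$. -/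

import Mathlib

open Real

noncomputable section

/-- The logarithmic mean of two positive numbers. -/
def logarithmicMean (x y : ℝ) : ℝ :=
  if x = y then x else (x - y) / (log x - log y)

/-- The identric (exponential) mean of two positive numbers,
`e⁻¹ * (x ^ x / y ^ y) ^ (1 / (x - y))` for `x ≠ y`. -/
def identricMean (x y : ℝ) : ℝ :=
  if x = y then x else exp ((x * log x - y * log y) / (x - y) - 1)

/-- The mean `Y = I * exp (1 - G ^ 2 / L ^ 2)`, where `I`, `L`, `G` are the identric,
logarithmic and geometric means. -/
def yMean (x y : ℝ) : ℝ :=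
  identricMean x y * exp (1 - √(x * y) ^ 2 / logarithmicMean x y ^ 2)

/-- The Stolarsky mean `S_{p,q}(a,b)`. -/
def stolarskyMean (p q a b : ℝ) : ℝ :=
  if a = b then a
  else if p = q then
    if p = 0 then √(a * b)
    else exp ((a ^ p * log a - b ^ p * log b) / (a ^ p - b ^ p) - 1 / p)
  else if q = 0 then ((a ^ p - b ^ p) / (p * (log a - log b))) ^ (1 / p)
  else if p = 0 then ((a ^ q - b ^ q) / (q * (log a - log b))) ^ (1 / q)
  else (q * (a ^ p - b ^ p) / (p * (a ^ q - b ^ q))) ^ (1 / (p - q))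

/-- The Gini mean `G_{p,q}(a,b)`. -/
def giniMean (p q a b : ℝ) : ℝ :=
  if p = q then exp ((a ^ p * log a + b ^ p * log b) / (a ^ p + b ^ p))
  else ((a ^ p + b ^ p) / (a ^ q + b ^ q)) ^ (1 / (p - q))

/-- The two-parameter identric (exponential) mean `I_{p,q}(a,b)`; its value at `p = q = 0`
is the limit `√(a * b)`. -/
def twoParamIdentricMean (p q a b : ℝ) : ℝ :=
  if p = q then
    if p = 0 then √(a * b)
    else yMean (a ^ p) (b ^ p) ^ (1 / p)
  else (identricMean (a ^ p) (b ^ p) / identricMean (a ^ q) (b ^ q)) ^ (1 / (p - q))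

/-- The two-parameter Heronian mean `He_{p,q}(a,b)`. -/
def twoParamHeronianMean (p q a b : ℝ) : ℝ :=
  if p = q then
    a ^ ((a ^ p + √(a * b) ^ p / 2) / (a ^ p + √(a * b) ^ p + b ^ p)) *
      b ^ ((√(a * b) ^ p / 2 + b ^ p) / (a ^ p + √(a * b) ^ p + b ^ p))
  else ((a ^ p + √(a * b) ^ p + b ^ p) / (a ^ q + √(a * b) ^ q + b ^ q)) ^ (1 / (p - q))

/-- `f` is positive on `s` and `log ∘ f` is strictly concave on `s`, jointly in both
variables. -/
def StrictLogConcaveOn (s : Set (ℝ × ℝ)) (f : ℝ × ℝ → ℝ) : Prop :=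
  (∀ z ∈ s, 0 < f z) ∧ StrictConcaveOn ℝ s (fun z => log (f z))

/-- `f` is positive on `s` and `log ∘ f` is strictly convex on `s`, jointly in both
variables. -/
def StrictLogConvexOn (s : Set (ℝ × ℝ)) (f : ℝ × ℝ → ℝ) : Prop :=
  (∀ z ∈ s, 0 < f z) ∧ StrictConvexOn ℝ s (fun z => log (f z))

end

/-! Write a = exp(m+h), b = exp(m-h) with h ≠ 0. In each family ln M is then the divided difference
at p, q of F(t) = m t + φ(h t), with F' on the diagonal, so ln M is the average of F' over the
segment from q to p. Averaging preserves strict concavity or convexity, now jointly in (p, q).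

It remains to study ψ = φ', which is odd in all four cases. If ψ is strictly concave on [0, ∞), then
so is F'(t) = m + h ψ(h t), and oddness gives strict convexity on (-∞, 0]. The four ψ are coth u -
1/u (Stolarsky), tanh u (Gini), (u coth u)' (identric) and 2 sinh u / (1 + 2 cosh u) (Heronian).
Concavity of the first is Lazarević's inequality, of the third the hyperbolic Cusa–Huygens
inequality at 2u; for the other two ψ' is a decreasing function of cosh u. -/

/-! ### Averages over segments -/

theorem strictConcaveOn_prod_integral {T : ℝ → ℝ} (hT : Continuous T) {D : Set ℝ}
    (hD : StrictConcaveOn ℝ D T) :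
    StrictConcaveOn ℝ (D ×ˢ D) (fun z : ℝ × ℝ => ∫ s in (0 : ℝ)..1, T (z.2 + s * (z.1 - z.2))) := by
  refine ⟨hD.1.prod hD.1, ?_⟩
  rintro ⟨x₁, x₂⟩ ⟨hx₁, hx₂⟩ ⟨y₁, y₂⟩ ⟨hy₁, hy₂⟩ hne α β hα hβ hαβ
  simp only at hx₁ hx₂ hy₁ hy₂
  simp only [smul_eq_mul, Prod.smul_mk, Prod.mk_add_mk]
  rw [← intervalIntegral.integral_const_mul, ← intervalIntegral.integral_const_mul,
    ← intervalIntegral.integral_add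
      ((by fun_prop : Continuous fun s => α * T (x₂ + s * (x₁ - x₂))).intervalIntegrable _ _)
      ((by fun_prop : Continuous fun s => β * T (y₂ + s * (y₁ - y₂))).intervalIntegrable _ _)]
  have key : ∀ s, α * x₂ + β * y₂ + s * (α * x₁ + β * y₁ - (α * x₂ + β * y₂)) =
      α • (x₂ + s * (x₁ - x₂)) + β • (y₂ + s * (y₁ - y₂)) := by
    intro s; simp only [smul_eq_mul]; ring
  have mem : ∀ {u v s : ℝ}, u ∈ D → v ∈ D → s ∈ Set.Icc (0 : ℝ) 1 → v + s * (u - v) ∈ D := by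
    intro u v s hu hv hs
    have := hD.1 hv hu (sub_nonneg.2 hs.2) hs.1 (by ring)
    simp only [smul_eq_mul] at this
    convert this using 1; ring
  refine intervalIntegral.integral_lt_integral_of_continuousOn_of_le_of_exists_lt zero_lt_one
    (by fun_prop) (by fun_prop) (fun s hs => ?_) ?_
  · have hs' := Set.Ioc_subset_Icc_self hs
    rw [key]
    exact hD.concaveOn.2 (mem hx₁ hx₂ hs') (mem hy₁ hy₂ hs') hα.le hβ.le hαβ
  -- Strictness at a single s suffices: s = 0 sees only the second coordinates and s = 1 only the
  -- first, and one of these pairs differs.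
  · by_cases h : x₂ = y₂
    · have h1 : x₁ ≠ y₁ := fun h' => hne (by rw [h, h'])
      refine ⟨1, by simp, ?_⟩
      rw [key]
      have h1m : (1 : ℝ) ∈ Set.Icc (0 : ℝ) 1 := by simp
      exact hD.2 (mem hx₁ hx₂ h1m) (mem hy₁ hy₂ h1m) (by simpa using h1) hα hβ hαβ
    · refine ⟨0, by simp, ?_⟩
      rw [key]
      have h0m : (0 : ℝ) ∈ Set.Icc (0 : ℝ) 1 := by simp
      exact hD.2 (mem hx₁ hx₂ h0m) (mem hy₁ hy₂ h0m) (by simpa using h) hα hβ hαβ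

theorem strictConvexOn_prod_integral {T : ℝ → ℝ} (hT : Continuous T) {D : Set ℝ}
    (hD : StrictConvexOn ℝ D T) :
    StrictConvexOn ℝ (D ×ˢ D) (fun z : ℝ × ℝ => ∫ s in (0 : ℝ)..1, T (z.2 + s * (z.1 - z.2))) := by
  have h := (strictConcaveOn_prod_integral hT.neg hD.neg).neg
  refine h.congr fun z _ => ?_
  simp [intervalIntegral.integral_neg]

/-! ### Divided differences and the general criterion -/

/-- The divided difference, extended to the diagonal by the derivative, of
`t ↦ m * t + φ (h * t)`, where `ψ` is the derivative of `φ`. -/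
noncomputable def dividedDifference (m h : ℝ) (φ ψ : ℝ → ℝ) (p q : ℝ) : ℝ :=
  if p = q then m + h * ψ (h * p)
  else ((m * p + φ (h * p)) - (m * q + φ (h * q))) / (p - q)

theorem dividedDifference_eq_integral (m h : ℝ) {φ ψ : ℝ → ℝ}
    (hφ : ∀ u, HasDerivAt φ (ψ u) u) (hψ : Continuous ψ) (p q : ℝ) :
    dividedDifference m h φ ψ p q =
      ∫ s in (0 : ℝ)..1, (fun t => m + h * ψ (h * t)) (q + s * (p - q)) := by
  unfold dividedDifference
  split_ifs with hpq
  · simp [hpq]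
  · have hne : p - q ≠ 0 := sub_ne_zero.2 hpq
    have hd : ∀ s : ℝ, HasDerivAt
        (fun s => (m * (q + s * (p - q)) + φ (h * (q + s * (p - q)))) / (p - q))
        (m + h * ψ (h * (q + s * (p - q)))) s := by
      intro s
      have h1 : HasDerivAt (fun s : ℝ => q + s * (p - q)) (p - q) s := by
        simpa using ((hasDerivAt_id s).mul_const (p - q)).const_add q
      have h2 := (hφ _).comp s (h1.const_mul h)
      refine (((h1.const_mul m).add h2).div_const (p - q)).congr_deriv ?_
      field_simp
    rw [intervalIntegral.integral_eq_sub_of_hasDerivAt (fun s _ => hd s)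
      ((by fun_prop : Continuous fun s => m + h * ψ (h * (q + s * (p - q)))).intervalIntegrable _ _)]
    simp only [one_mul, zero_mul, add_zero, add_sub_cancel]
    ring

theorem strictLogConcaveOn_and_strictLogConvexOn {M : ℝ → ℝ → ℝ} {m h : ℝ} {φ ψ : ℝ → ℝ}
    (hh : h ≠ 0) (hφ : ∀ u, HasDerivAt φ (ψ u) u) (hψ : Continuous ψ)
    (hodd : ∀ u, ψ (-u) = -ψ u) (hconc : StrictConcaveOn ℝ (Set.Ici 0) ψ)
    (hM : ∀ p q, M p q = exp (dividedDifference m h φ ψ p q)) :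
    StrictLogConcaveOn (Set.Ici 0 ×ˢ Set.Ici 0) (fun z => M z.1 z.2) ∧
      StrictLogConvexOn (Set.Iic 0 ×ˢ Set.Iic 0) (fun z => M z.1 z.2) := by
  have hlog : ∀ p q, log (M p q) =
      ∫ s in (0 : ℝ)..1, (fun t => m + h * ψ (h * t)) (q + s * (p - q)) := fun p q => by
    rw [hM, log_exp, dividedDifference_eq_integral m h hφ hψ]
  have hpos : ∀ p q, 0 < M p q := fun p q => by rw [hM]; exact exp_pos _
  have hT : Continuous fun t => m + h * ψ (h * t) := by fun_prop
  have habs : 0 < |h| := abs_pos.2 hh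
  -- Oddness of ψ makes the sign of h irrelevant, so h t may be assumed to stay in [0, ∞) with t.
  have hTabs : ∀ t, h * ψ (h * t) = |h| * ψ (|h| * t) := fun t => by
    rcases abs_choice h with h' | h' <;> rw [h']
    rw [neg_mul h t, hodd]; ring
  have hC : StrictConcaveOn ℝ (Set.Ici 0) fun t => m + h * ψ (h * t) := by
    refine ⟨convex_Ici 0, fun x hx y hy hxy α β hα hβ hαβ => ?_⟩
    have := hconc.2 (mul_nonneg habs.le hx) (mul_nonneg habs.le hy)
      (fun e => hxy (mul_left_cancel₀ habs.ne' e)) hα hβ hαβ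
    simp only [smul_eq_mul, hTabs] at this ⊢
    rw [show α * (|h| * x) + β * (|h| * y) = |h| * (α * x + β * y) by ring] at this
    have := mul_lt_mul_of_pos_left this habs
    have hm : m = α * m + β * m := by rw [← add_mul, hαβ, one_mul]
    linarith
  have hV : StrictConvexOn ℝ (Set.Iic 0) fun t => m + h * ψ (h * t) := by
    refine ⟨convex_Iic 0, fun x hx y hy hxy α β hα hβ hαβ => ?_⟩
    have := hC.2 (Set.mem_Ici.2 (neg_nonneg.2 hx)) (Set.mem_Ici.2 (neg_nonneg.2 hy))
      (fun e => hxy (neg_injective e)) hα hβ hαβ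
    simp only [smul_eq_mul] at this ⊢
    rw [show h * (α * -x + β * -y) = -(h * (α * x + β * y)) by ring, mul_neg, mul_neg,
      hodd, hodd, hodd] at this
    have hm : m = α * m + β * m := by rw [← add_mul, hαβ, one_mul]
    linarith
  refine ⟨⟨fun z _ => hpos _ _, ?_⟩, ⟨fun z _ => hpos _ _, ?_⟩⟩
  · simp only [hlog]
    exact strictConcaveOn_prod_integral hT hC
  · simp only [hlog]
    exact strictConvexOn_prod_integral hT hV

/-! ### Monotonicity criteria and hyperbolic inequalities -/

theorem strictConcaveOn_Ici_of_hasDerivAt {f f' : ℝ → ℝ} (hf : Continuous f)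
    (hf' : ∀ u, 0 < u → HasDerivAt f (f' u) u) (hanti : StrictAntiOn f' (Set.Ioi 0)) :
    StrictConcaveOn ℝ (Set.Ici 0) f := by
  refine StrictAntiOn.strictConcaveOn_of_deriv (convex_Ici 0) hf.continuousOn ?_
  rw [interior_Ici]
  exact hanti.congr fun u hu => ((hf' u hu).deriv).symm

theorem strictAntiOn_Ioi_of_hasDerivAt {f f' : ℝ → ℝ}
    (hf' : ∀ u, 0 < u → HasDerivAt f (f' u) u) (hneg : ∀ u, 0 < u → f' u < 0) :
    StrictAntiOn f (Set.Ioi 0) := by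
  refine strictAntiOn_of_deriv_neg (convex_Ioi 0)
    (fun u hu => (hf' u hu).continuousAt.continuousWithinAt) fun u hu => ?_
  rw [interior_Ioi] at hu
  rw [(hf' u hu).deriv]
  exact hneg u hu

theorem pos_of_hasDerivAt_pos {f f' : ℝ → ℝ} (hf : Continuous f) (h0 : f 0 = 0)
    (hf' : ∀ u, 0 < u → HasDerivAt f (f' u) u) (hpos : ∀ u, 0 < u → 0 < f' u)
    {u : ℝ} (hu : 0 < u) : 0 < f u := by
  have hm : StrictMonoOn f (Set.Ici 0) := by
    refine strictMonoOn_of_deriv_pos (convex_Ici 0) hf.continuousOn fun v hv => ?_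
    rw [interior_Ici] at hv
    rw [(hf' v hv).deriv]
    exact hpos v hv
  simpa [h0] using hm Set.self_mem_Ici hu.le hu

/-- Start of a chain ending in Cusa–Huygens: each difference vanishes at 0 and has the previous one
as derivative; here the derivative is u sinh u. -/
theorem sinh_lt_self_mul_cosh {u : ℝ} (hu : 0 < u) : sinh u < u * cosh u := by
  have := pos_of_hasDerivAt_pos (f := fun u => u * cosh u - sinh u) (f' := fun u => u * sinh u)
    (by fun_prop) (by simp)
    (fun v _ => (((hasDerivAt_id v).mul (hasDerivAt_cosh v)).sub (hasDerivAt_sinh v)).congr_deriv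
      (by simp))
    (fun v hv => mul_pos hv (sinh_pos_iff.2 hv)) hu
  linarith

theorem two_mul_cosh_sub_one_lt {u : ℝ} (hu : 0 < u) : 2 * (cosh u - 1) < u * sinh u := by
  have := pos_of_hasDerivAt_pos (f := fun u => u * sinh u - 2 * (cosh u - 1))
    (f' := fun u => u * cosh u - sinh u) (by fun_prop) (by simp)
    (fun v _ => (((hasDerivAt_id v).mul (hasDerivAt_sinh v)).sub
      (((hasDerivAt_cosh v).sub_const 1).const_mul 2)).congr_deriv (by simp; ring))
    (fun v hv => sub_pos.2 (sinh_lt_self_mul_cosh hv)) hu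
  linarith

/-- The hyperbolic Cusa–Huygens inequality. -/
theorem three_mul_sinh_lt {u : ℝ} (hu : 0 < u) : 3 * sinh u < u * (2 + cosh u) := by
  have := pos_of_hasDerivAt_pos (f := fun u => u * (2 + cosh u) - 3 * sinh u)
    (f' := fun u => u * sinh u - 2 * (cosh u - 1)) (by fun_prop) (by simp)
    (fun v _ => (((hasDerivAt_id v).mul ((hasDerivAt_cosh v).const_add 2)).sub
      ((hasDerivAt_sinh v).const_mul 3)).congr_deriv (by simp; ring))
    (fun v hv => sub_pos.2 (two_mul_cosh_sub_one_lt hv)) hu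
  linarith

theorem sinh_ne_zero_of_ne_zero {u : ℝ} (hu : u ≠ 0) : sinh u ≠ 0 := by
  rcases hu.lt_or_gt with h | h
  · exact (sinh_neg_iff.2 h).ne
  · exact (sinh_pos_iff.2 h).ne'

theorem sinh_div_self_pos {u : ℝ} (hu : u ≠ 0) : 0 < sinh u / u := by
  rcases hu.lt_or_gt with h | h
  · exact div_pos_of_neg_of_neg (sinh_neg_iff.2 h) h
  · exact div_pos (sinh_pos_iff.2 h) h

theorem hasDerivAt_log_sinh_div_self {u : ℝ} (hu : u ≠ 0) :
    HasDerivAt (fun u => log (sinh u / u)) (cosh u / sinh u - 1 / u) u := by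
  have hs := sinh_ne_zero_of_ne_zero hu
  refine (((hasDerivAt_sinh u).div (hasDerivAt_id u) hu).log
    (div_ne_zero hs hu)).congr_deriv ?_
  simp only [id, Pi.div_apply]
  field_simp

theorem continuous_log_sinh_div_self : Continuous fun u => log (sinh u / u) := by
  rw [continuous_iff_continuousAt]
  intro u
  rcases eq_or_ne u 0 with rfl | hu
  -- At 0 the conventions 0/0 = 0 and log 0 = 0 happen to give the true limit log 1.
  · have h1 : ContinuousAt (dslope sinh 0) 0 :=
      continuousAt_dslope_same.2 differentiable_sinh.differentiableAt
    have h2 : dslope sinh 0 0 = 1 := by simp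
    have h3 : (fun u => log (sinh u / u)) = fun u => log (dslope sinh 0 u) := by
      funext u
      rcases eq_or_ne u 0 with rfl | hu
      · simp
      · rw [dslope_of_ne _ hu]; simp [slope_def_field]
    rw [h3]
    exact h1.log (by rw [h2]; exact one_ne_zero)
  · exact (hasDerivAt_log_sinh_div_self hu).continuousAt

/-- Lazarević's inequality. -/
theorem pow_three_mul_cosh_lt {u : ℝ} (hu : 0 < u) : u ^ 3 * cosh u < sinh u ^ 3 := by
  have hpos := pos_of_hasDerivAt_pos (f := fun u => 3 * log (sinh u / u) - log (cosh u))
    (f' := fun u => 3 * (cosh u / sinh u - 1 / u) - sinh u / cosh u)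
    ((continuous_log_sinh_div_self.const_mul 3).sub
      (continuous_cosh.log fun v => (cosh_pos v).ne')) (by simp)
    (fun v hv => ((hasDerivAt_log_sinh_div_self hv.ne').const_mul 3).sub
      ((hasDerivAt_cosh v).log (cosh_pos v).ne'))
    (fun v hv => by
      have hs := sinh_pos_iff.2 hv
      have hc := cosh_pos v
      -- Cusa–Huygens at 2v is exactly positivity of the numerator of the derivative.
      have h := three_mul_sinh_lt (mul_pos two_pos hv)
      rw [sinh_two_mul, cosh_two_mul] at h
      have : 3 * (cosh v / sinh v - 1 / v) - sinh v / cosh v =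
          (v * (2 + (cosh v ^ 2 + sinh v ^ 2)) - 3 * (sinh v * cosh v)) /
            (v * sinh v * cosh v) := by
        field_simp
        linear_combination (2 * v) * cosh_sq v
      rw [this]
      apply div_pos _ (by positivity)
      linarith) hu
  have hs := sinh_pos_iff.2 hu
  have h3 : log (cosh u) < log ((sinh u / u) ^ 3) := by
    rw [log_pow]; push_cast; linarith
  have h4 := (log_lt_log_iff (cosh_pos u) (by positivity)).1 h3
  rw [div_pow, lt_div_iff₀ (by positivity)] at h4
  linarith

/-- Oddness forces f 0 = 0 and carries the one-sided bound to negative u. This handles the removable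
singularities of ψ. -/
theorem continuousAt_zero_of_odd_of_abs_le {f : ℝ → ℝ} {C : ℝ} (hodd : ∀ u, f (-u) = -f u)
    (h : ∀ u, 0 < u → |f u| ≤ C * u) : ContinuousAt f 0 := by
  have h0 : f 0 = 0 := by have := hodd 0; rw [neg_zero] at this; linarith
  have hle : ∀ u, |f u| ≤ C * |u| := by
    intro u
    rcases lt_trichotomy u 0 with hu | rfl | hu
    · have := h (-u) (neg_pos.2 hu)
      rwa [hodd, abs_neg, ← abs_of_neg hu] at this
    · simp [h0]
    · rw [abs_of_pos hu]; exact h u hu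
  rw [ContinuousAt, h0]
  refine squeeze_zero_norm hle ?_
  have : Continuous fun u : ℝ => C * |u| := by fun_prop
  simpa using this.tendsto 0

/-! ### Stolarsky case: the Langevin function -/

/-- The Langevin function; its value at `0` is `0`. -/
noncomputable def langevin (u : ℝ) : ℝ := cosh u / sinh u - 1 / u

theorem langevin_neg (u : ℝ) : langevin (-u) = -langevin u := by
  simp only [langevin, cosh_neg, sinh_neg, div_neg]; ring

theorem hasDerivAt_langevin {u : ℝ} (hu : u ≠ 0) :
    HasDerivAt langevin (1 / u ^ 2 - 1 / sinh u ^ 2) u := by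
  have hs := sinh_ne_zero_of_ne_zero hu
  refine (((hasDerivAt_cosh u).div (hasDerivAt_sinh u) hs).sub
    ((hasDerivAt_const u (1 : ℝ)).div (hasDerivAt_id u) hu)).congr_deriv ?_
  simp only [id]
  field_simp
  linear_combination (-u ^ 2) * cosh_sq u

theorem continuous_langevin : Continuous langevin := by
  rw [continuous_iff_continuousAt]
  intro u
  rcases eq_or_ne u 0 with rfl | hu
  · refine continuousAt_zero_of_odd_of_abs_le (C := 1) langevin_neg fun u hu => ?_
    have hs := sinh_pos_iff.2 hu
    have h1 := sinh_lt_self_mul_cosh hu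
    have h2 := self_lt_sinh_iff.2 hu
    have h3 := two_mul_cosh_sub_one_lt hu
    have h4 : langevin u = (u * cosh u - sinh u) / (u * sinh u) := by
      unfold langevin; field_simp
    rw [h4, abs_of_pos (div_pos (by linarith) (by positivity)), div_le_iff₀ (by positivity)]
    have := one_lt_cosh.2 hu.ne'
    nlinarith
  · exact (hasDerivAt_langevin hu).continuousAt

/-- At 0 the derivative is obtained as the limit of the derivatives nearby. -/
theorem hasDerivAt_log_sinh_div_self_langevin (u : ℝ) :
    HasDerivAt (fun u => log (sinh u / u)) (langevin u) u :=
  hasDerivAt_of_hasDerivAt_of_ne' (x := 0) (fun _ hv => hasDerivAt_log_sinh_div_self hv)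
    continuous_log_sinh_div_self.continuousAt continuous_langevin.continuousAt u

theorem strictConcaveOn_langevin : StrictConcaveOn ℝ (Set.Ici 0) langevin := by
  refine strictConcaveOn_Ici_of_hasDerivAt continuous_langevin
    (fun u hu => hasDerivAt_langevin hu.ne')
    (strictAntiOn_Ioi_of_hasDerivAt (f' := fun u => 2 * cosh u / sinh u ^ 3 - 2 / u ^ 3)
      (fun u hu => ?_) fun u hu => ?_)
  · have hs := sinh_pos_iff.2 hu
    refine (((hasDerivAt_const u (1 : ℝ)).div (hasDerivAt_pow 2 u) (by positivity)).sub
      ((hasDerivAt_const u (1 : ℝ)).div ((hasDerivAt_sinh u).pow 2)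
        (pow_ne_zero 2 hs.ne'))).congr_deriv ?_
    simp only [Pi.pow_apply]
    field_simp
    ring
  · have hs := sinh_pos_iff.2 hu
    have h := pow_three_mul_cosh_lt hu
    rw [sub_neg, div_lt_div_iff₀ (by positivity) (by positivity)]
    linarith

/-! ### Identric case: the derivative of u coth u -/

/-- The derivative of `u * coth u`, extended by `0` at `0`. -/
noncomputable def mulCothDeriv (u : ℝ) : ℝ := cosh u / sinh u - u / sinh u ^ 2

theorem mulCothDeriv_neg (u : ℝ) : mulCothDeriv (-u) = -mulCothDeriv u := by
  simp only [mulCothDeriv, cosh_neg, sinh_neg, div_neg, neg_sq]; ring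

theorem hasDerivAt_mulCothDeriv {u : ℝ} (hu : u ≠ 0) :
    HasDerivAt mulCothDeriv (2 * (u * cosh u - sinh u) / sinh u ^ 3) u := by
  have hs := sinh_ne_zero_of_ne_zero hu
  refine (((hasDerivAt_cosh u).div (hasDerivAt_sinh u) hs).sub
    ((hasDerivAt_id u).div ((hasDerivAt_sinh u).pow 2) (pow_ne_zero 2 hs))).congr_deriv ?_
  simp only [id, Pi.pow_apply]
  field_simp
  push_cast
  linear_combination (-sinh u ^ 2) * cosh_sq u

theorem continuous_mulCothDeriv : Continuous mulCothDeriv := by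
  rw [continuous_iff_continuousAt]
  intro u
  rcases eq_or_ne u 0 with rfl | hu
  · refine continuousAt_zero_of_odd_of_abs_le (C := 2) mulCothDeriv_neg fun u hu => ?_
    have hs := sinh_pos_iff.2 hu
    have h1 := self_lt_sinh_iff.2 hu
    have h2 := one_lt_cosh.2 hu.ne'
    have h3 := sinh_lt_self_mul_cosh (mul_pos two_pos hu)
    rw [sinh_two_mul, cosh_two_mul, cosh_sq] at h3
    have h4 : mulCothDeriv u = (sinh u * cosh u - u) / sinh u ^ 2 := by
      unfold mulCothDeriv; field_simp
    rw [h4, abs_of_pos (div_pos (by nlinarith) (by positivity)), div_le_iff₀ (by positivity)]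
    linarith
  · exact (hasDerivAt_mulCothDeriv hu).continuousAt

theorem hasDerivAt_mul_langevin (u : ℝ) :
    HasDerivAt (fun u => u * langevin u) (mulCothDeriv u) u := by
  refine hasDerivAt_of_hasDerivAt_of_ne' (x := 0) (fun v hv => ?_)
    (continuous_id.mul continuous_langevin).continuousAt continuous_mulCothDeriv.continuousAt u
  have hs := sinh_ne_zero_of_ne_zero hv
  refine ((hasDerivAt_id v).mul (hasDerivAt_langevin hv)).congr_deriv ?_
  simp only [id, langevin, mulCothDeriv]
  field_simp
  ring

theorem strictConcaveOn_mulCothDeriv : StrictConcaveOn ℝ (Set.Ici 0) mulCothDeriv := by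
  refine strictConcaveOn_Ici_of_hasDerivAt continuous_mulCothDeriv
    (fun u hu => hasDerivAt_mulCothDeriv hu.ne')
    (strictAntiOn_Ioi_of_hasDerivAt
      (f' := fun u => 2 * (3 * sinh u * cosh u - u * (2 * cosh u ^ 2 + 1)) / sinh u ^ 4)
      (fun u hu => ?_) fun u hu => ?_)
  · have hs := sinh_pos_iff.2 hu
    refine (((((hasDerivAt_id u).mul (hasDerivAt_cosh u)).sub (hasDerivAt_sinh u)).const_mul
      2).div ((hasDerivAt_sinh u).pow 3) (pow_ne_zero 3 hs.ne')).congr_deriv ?_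
    simp only [id, Pi.pow_apply, Pi.mul_apply, Pi.sub_apply]
    field_simp
    push_cast
    linear_combination (-sinh u ^ 2 * u) * cosh_sq u
  · have hs := sinh_pos_iff.2 hu
    -- In terms of cosh u, this is negativity of the numerator of the second derivative.
    have h := three_mul_sinh_lt (mul_pos two_pos hu)
    rw [sinh_two_mul, cosh_two_mul, sinh_sq] at h
    exact div_neg_of_neg_of_pos (by linarith) (by positivity)

/-! ### Gini and Heronian cases -/

theorem strictAntiOn_comp_cosh {f : ℝ → ℝ} (hf : StrictAntiOn f (Set.Ici 1)) :
    StrictAntiOn (fun u => f (cosh u)) (Set.Ioi 0) := fun u hu v hv huv =>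
  hf (one_le_cosh u) (one_le_cosh v) (cosh_strictMonoOn (Set.mem_Ioi.1 hu).le (Set.mem_Ioi.1 hv).le huv)

theorem hasDerivAt_log_cosh (u : ℝ) : HasDerivAt (fun u => log (cosh u)) (tanh u) u :=
  ((hasDerivAt_cosh u).log (cosh_pos u).ne').congr_deriv (tanh_eq_sinh_div_cosh u).symm

theorem hasDerivAt_tanh_one_div_cosh_sq (u : ℝ) : HasDerivAt tanh (1 / cosh u ^ 2) u := by
  have hc := (cosh_pos u).ne'
  have h : tanh = fun u => sinh u / cosh u := funext tanh_eq_sinh_div_cosh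
  rw [h]
  refine ((hasDerivAt_sinh u).div (hasDerivAt_cosh u) hc).congr_deriv ?_
  rw [← sq, ← sq, cosh_sq]; simp

theorem continuous_real_tanh : Continuous tanh :=
  continuous_iff_continuousAt.2 fun u => (hasDerivAt_tanh_one_div_cosh_sq u).continuousAt

theorem strictConcaveOn_tanh : StrictConcaveOn ℝ (Set.Ici 0) tanh := by
  refine strictConcaveOn_Ici_of_hasDerivAt continuous_real_tanh
    (fun u _ => hasDerivAt_tanh_one_div_cosh_sq u)
    (strictAntiOn_comp_cosh (f := fun c => 1 / c ^ 2) fun c hc d hd hcd => ?_)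
  have hc' : (0 : ℝ) < c := zero_lt_one.trans_le hc
  simp only
  gcongr

/-- The derivative of `log (1 + 2 * cosh u)`. -/
noncomputable def heronianTanh (u : ℝ) : ℝ := 2 * sinh u / (1 + 2 * cosh u)

theorem heronianTanh_neg (u : ℝ) : heronianTanh (-u) = -heronianTanh u := by
  simp only [heronianTanh, cosh_neg, sinh_neg]; ring

theorem one_add_two_mul_cosh_pos (u : ℝ) : 0 < 1 + 2 * cosh u := by
  have := cosh_pos u; positivity

theorem hasDerivAt_log_one_add_two_mul_cosh (u : ℝ) :
    HasDerivAt (fun u => log (1 + 2 * cosh u)) (heronianTanh u) u :=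
  (((hasDerivAt_cosh u).const_mul 2).const_add 1).log (one_add_two_mul_cosh_pos u).ne'

theorem hasDerivAt_heronianTanh (u : ℝ) :
    HasDerivAt heronianTanh ((2 * cosh u + 4) / (1 + 2 * cosh u) ^ 2) u := by
  refine (((hasDerivAt_sinh u).const_mul 2).div
    (((hasDerivAt_cosh u).const_mul 2).const_add 1)
    (one_add_two_mul_cosh_pos u).ne').congr_deriv ?_
  congr 1
  linear_combination 4 * cosh_sq u

theorem continuous_heronianTanh : Continuous heronianTanh :=
  continuous_iff_continuousAt.2 fun u => (hasDerivAt_heronianTanh u).continuousAt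

theorem strictConcaveOn_heronianTanh : StrictConcaveOn ℝ (Set.Ici 0) heronianTanh := by
  refine strictConcaveOn_Ici_of_hasDerivAt continuous_heronianTanh
    (fun u _ => hasDerivAt_heronianTanh u)
    (strictAntiOn_comp_cosh (f := fun c => (2 * c + 4) / (1 + 2 * c) ^ 2) fun c hc d hd hcd => ?_)
  rw [Set.mem_Ici] at hc hd
  -- Partial fractions make both summands visibly decreasing.
  have h : ∀ x : ℝ, 1 ≤ x → (2 * x + 4) / (1 + 2 * x) ^ 2 =
      1 / (1 + 2 * x) + 3 / (1 + 2 * x) ^ 2 := fun x hx => by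
    have : 0 < 1 + 2 * x := by positivity
    field_simp
    ring
  simp only
  rw [h c hc, h d hd]
  gcongr

/-! ### The four means as exponentials of divided differences -/

theorem exp_add_rpow (m h p : ℝ) :
    exp (m + h) ^ p = exp (m * p) * (cosh (h * p) + sinh (h * p)) := by
  rw [← exp_mul, add_mul, exp_add, cosh_add_sinh]

theorem exp_sub_rpow (m h p : ℝ) :
    exp (m - h) ^ p = exp (m * p) * (cosh (h * p) - sinh (h * p)) := by
  rw [← exp_mul, sub_mul, exp_sub, cosh_sub_sinh, exp_neg, div_eq_mul_inv]

theorem sqrt_exp_add_mul_exp_sub (m h : ℝ) : √(exp (m + h) * exp (m - h)) = exp m := by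
  rw [← exp_add, show m + h + (m - h) = m + m by ring, exp_add, sqrt_mul_self (exp_pos m).le]

theorem exp_rpow_one_div (x r : ℝ) : exp x ^ (1 / r) = exp (x / r) := by
  rw [← exp_mul, mul_one_div]

theorem exp_add_ne_exp_sub {m h : ℝ} (hh : h ≠ 0) : exp (m + h) ≠ exp (m - h) := fun e =>
  hh (by have := exp_injective e; linarith)

theorem giniMean_eq (m h p q : ℝ) :
    giniMean p q (exp (m + h)) (exp (m - h)) =
      exp (dividedDifference m h (fun u => log (cosh u)) tanh p q) := by
  have key : ∀ t, exp (m + h) ^ t + exp (m - h) ^ t =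
      2 * exp (m * t + log (cosh (h * t))) := fun t => by
    rw [exp_add_rpow, exp_sub_rpow, exp_add, exp_log (cosh_pos _)]; ring
  unfold giniMean dividedDifference
  split_ifs with hpq
  · subst hpq
    rw [key, exp_add_rpow, exp_sub_rpow, log_exp, log_exp, exp_add, exp_log (cosh_pos _),
      tanh_eq_sinh_div_cosh]
    have := cosh_pos (h * p)
    congr 1
    field_simp
    ring
  · rw [key, key, mul_div_mul_left _ _ two_ne_zero, ← exp_sub, exp_rpow_one_div]

theorem stolarskyMean_eq {m h : ℝ} (hh : h ≠ 0) (p q : ℝ) :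
    stolarskyMean p q (exp (m + h)) (exp (m - h)) =
      exp (dividedDifference m h (fun u => log (sinh u / u)) langevin p q) := by
  -- The factor 2h is log a - log b, and t cancels against the p or q in the definition.
  have key : ∀ t, t ≠ 0 → exp (m + h) ^ t - exp (m - h) ^ t =
      2 * h * t * exp (m * t + log (sinh (h * t) / (h * t))) := fun t ht => by
    have hht := mul_ne_zero hh ht
    rw [exp_add_rpow, exp_sub_rpow, exp_add, exp_log (sinh_div_self_pos hht)]
    field_simp
    ring
  have hsub : m + h - (m - h) = 2 * h := by ring
  unfold stolarskyMean dividedDifference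
  rw [if_neg (exp_add_ne_exp_sub hh)]
  simp only [log_exp, hsub]
  split_ifs with hpq hp hq hp
  · subst hpq hp
    rw [sqrt_exp_add_mul_exp_sub]; simp [langevin]
  · subst hpq
    have hhp := mul_ne_zero hh hp
    have hs := sinh_ne_zero_of_ne_zero hhp
    congr 1
    rw [exp_add_rpow, exp_sub_rpow, langevin, ← mul_sub, add_sub_sub_cancel]
    field_simp
    ring
  · subst hq
    rw [key p hpq, show 2 * h * p = p * (2 * h) by ring, mul_div_cancel_left₀ _ (by positivity),
      exp_rpow_one_div]
    simp
  · subst hp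
    rw [key q hq, show 2 * h * q = q * (2 * h) by ring, mul_div_cancel_left₀ _ (by positivity),
      exp_rpow_one_div]
    congr 1
    simp
    field_simp
    ring
  · rw [key p hp, key q hq, ← exp_rpow_one_div, exp_sub]
    congr 1
    field_simp

theorem log_exp_rpow (x t : ℝ) : log (exp x ^ t) = x * t := by rw [← exp_mul, log_exp]

theorem exp_add_rpow_ne_exp_sub_rpow {h t : ℝ} (m : ℝ) (hht : h * t ≠ 0) :
    exp (m + h) ^ t ≠ exp (m - h) ^ t := fun e => by
  have := congrArg log e
  rw [log_exp_rpow, log_exp_rpow] at this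
  exact hht (by linarith)

theorem identricMean_rpow_eq {h : ℝ} (hh : h ≠ 0) (m t : ℝ) :
    identricMean (exp (m + h) ^ t) (exp (m - h) ^ t) =
      exp (m * t + h * t * langevin (h * t)) := by
  rcases eq_or_ne t 0 with rfl | ht
  -- Both sides are 1; this covers p or q equal to 0 off the diagonal.
  · simp [identricMean]
  have hht := mul_ne_zero hh ht
  have hs := sinh_ne_zero_of_ne_zero hht
  rw [identricMean, if_neg (exp_add_rpow_ne_exp_sub_rpow m hht),
    log_exp_rpow, log_exp_rpow, exp_add_rpow, exp_sub_rpow, ← mul_sub,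
    add_sub_sub_cancel, langevin]
  congr 1
  field_simp
  ring

/-- With u = h t one has G / L = u / sinh u, so 1 - G²/L² turns u coth u - 1 into u coth u - u² /
sinh² u = u (u coth u)'. -/
theorem yMean_rpow_eq {h t : ℝ} (hh : h ≠ 0) (ht : t ≠ 0) (m : ℝ) :
    yMean (exp (m + h) ^ t) (exp (m - h) ^ t) =
      exp (m * t + h * t * mulCothDeriv (h * t)) := by
  have hht := mul_ne_zero hh ht
  have hs := sinh_ne_zero_of_ne_zero hht
  rw [yMean, identricMean_rpow_eq hh, ← exp_add, logarithmicMean, if_neg (exp_add_rpow_ne_exp_sub_rpow m hht),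
    log_exp_rpow, log_exp_rpow,
    sq_sqrt (by positivity), exp_add_rpow, exp_sub_rpow, ← mul_sub, add_sub_sub_cancel,
    langevin, mulCothDeriv]
  congr 1
  field_simp
  linear_combination (-4 * (h * t) ^ 2) * cosh_sq (t * h)

theorem twoParamIdentricMean_eq {m h : ℝ} (hh : h ≠ 0) (p q : ℝ) :
    twoParamIdentricMean p q (exp (m + h)) (exp (m - h)) =
      exp (dividedDifference m h (fun u => u * langevin u) mulCothDeriv p q) := by
  unfold twoParamIdentricMean dividedDifference
  split_ifs with hpq hp
  · subst hp
    rw [sqrt_exp_add_mul_exp_sub]; simp [mulCothDeriv]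
  · rw [yMean_rpow_eq hh hp, exp_rpow_one_div]
    congr 1
    field_simp
  · rw [identricMean_rpow_eq hh, identricMean_rpow_eq hh, ← exp_sub, exp_rpow_one_div]

theorem twoParamHeronianMean_eq (m h p q : ℝ) :
    twoParamHeronianMean p q (exp (m + h)) (exp (m - h)) =
      exp (dividedDifference m h (fun u => log (1 + 2 * cosh u)) heronianTanh p q) := by
  have key : ∀ t, exp (m + h) ^ t + exp m ^ t + exp (m - h) ^ t =
      exp (m * t + log (1 + 2 * cosh (h * t))) := fun t => by
    rw [exp_add_rpow, exp_sub_rpow, exp_add, exp_log (one_add_two_mul_cosh_pos _), ← exp_mul]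
    ring
  unfold twoParamHeronianMean dividedDifference
  rw [sqrt_exp_add_mul_exp_sub]
  split_ifs with hpq
  · have hc := one_add_two_mul_cosh_pos (h * p)
    rw [key, ← exp_mul, ← exp_mul (m - h), ← exp_add, exp_add_rpow, exp_sub_rpow, exp_add (m * p),
      exp_log hc, ← exp_mul, heronianTanh]
    congr 1
    field_simp
    ring
  · rw [key, key, ← exp_sub, exp_rpow_one_div]

theorem corollary3p1 (a b : ℝ) (ha : 0 < a) (hb : 0 < b) (hab : a ≠ b) :
    (StrictLogConcaveOn (Set.Ici 0 ×ˢ Set.Ici 0) (fun z => stolarskyMean z.1 z.2 a b) ∧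
      StrictLogConvexOn (Set.Iic 0 ×ˢ Set.Iic 0) (fun z => stolarskyMean z.1 z.2 a b)) ∧
    (StrictLogConcaveOn (Set.Ici 0 ×ˢ Set.Ici 0) (fun z => giniMean z.1 z.2 a b) ∧
      StrictLogConvexOn (Set.Iic 0 ×ˢ Set.Iic 0) (fun z => giniMean z.1 z.2 a b)) ∧
    (StrictLogConcaveOn (Set.Ici 0 ×ˢ Set.Ici 0) (fun z => twoParamIdentricMean z.1 z.2 a b) ∧
      StrictLogConvexOn (Set.Iic 0 ×ˢ Set.Iic 0)
        (fun z => twoParamIdentricMean z.1 z.2 a b)) ∧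
    (StrictLogConcaveOn (Set.Ici 0 ×ˢ Set.Ici 0) (fun z => twoParamHeronianMean z.1 z.2 a b) ∧
      StrictLogConvexOn (Set.Iic 0 ×ˢ Set.Iic 0)
        (fun z => twoParamHeronianMean z.1 z.2 a b)) := by
  obtain ⟨m, h, rfl, rfl⟩ : ∃ m h, a = exp (m + h) ∧ b = exp (m - h) := by
    refine ⟨(log a + log b) / 2, (log a - log b) / 2, ?_, ?_⟩
    · ring_nf; rw [exp_log ha]
    · ring_nf; rw [exp_log hb]
  have hh : h ≠ 0 := by rintro rfl; simp at hab
  exact ⟨strictLogConcaveOn_and_strictLogConvexOn hh hasDerivAt_log_sinh_div_self_langevin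
      continuous_langevin langevin_neg strictConcaveOn_langevin (stolarskyMean_eq hh),
    strictLogConcaveOn_and_strictLogConvexOn hh hasDerivAt_log_cosh
      continuous_real_tanh tanh_neg
      strictConcaveOn_tanh (giniMean_eq m h),
    strictLogConcaveOn_and_strictLogConvexOn hh hasDerivAt_mul_langevin continuous_mulCothDeriv
      mulCothDeriv_neg strictConcaveOn_mulCothDeriv (twoParamIdentricMean_eq hh),
    strictLogConcaveOn_and_strictLogConvexOn hh hasDerivAt_log_one_add_two_mul_cosh
      continuous_heronianTanh heronianTanh_neg strictConcaveOn_heronianTanh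
      (twoParamHeronianMean_eq m h)⟩
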